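/- **Setting.** An orbifold is a proper étale smooth groupoid $G=(G_1\rightrightarrows G_0)$: $G_0,G_1$ are smooth Hausdorff $n$-manifolds, the structure maps are smooth, the source $s$ and target $t$ are local diffeomorphisms, and $(s,t):G_1\to G_0\times G_0$ is proper. For $t(a)=s(b)$ the composite of $a$ followed by $b$ is written $ab$, and $G_2$ is the space of composable pairs. A *gerbe with connection* over such a groupoid (for instance over a Leray description of a given orbifold) is a Čech 2-cocycle $(h,A,B)$ with values in $\mathbb C^\times\xrightarrow{d\log}\mathcal A^1\xrightarrow{d}\mathcal A^2$: a smooth function $h:G_2\to\mathbb C^\times$, a complex 1-form $A$ on $G_1$ and a complex 2-form $B$ on $G_0$ with $$s^*B-t^*B=dA,\qquad A(b)-A(ab)+A(a)=d\log h(a,b)\ \text{ on } G_2,\qquad h(b,c)\,h(ab,c)^{-1}\,h(a,bc)\,h(a,b)^{-1}=1 .$$ A *line bundle with connection* over a smooth groupoid $H$ is a pair $(\rho,\nabla)$ of a smooth function $\rho:H_1\to\mathbb C^\times$ with $\rho(gg')=\rho(g)\rho(g')$ and a complex 1-form $\nabla$ on $H_0$ with $s^*\nabla-t^*\nabla=d\log\rho$;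 it is *flat* if $d\nabla=0$. An isomorphism $(\rho,\nabla)\to(\rho',\nabla')$ is a smooth $f:H_0\to\mathbb C^\times$ with $f(t(g))\rho(g)=\rho'(g)f(s(g))$ and $\nabla-\nabla'=d\log f$. The *inertia groupoid* $\wedge G$, which represents the disjoint union of all the sectors of the orbifold, has objects $\wedge G_0=\{a\in G_1: s(a)=t(a)\}$ and arrows $\wedge G_1=\{(a,b)\in G_2: a\in\wedge G_0\}$, with source $a$ and target $b^{-1}ab$; smooth functions and forms on $\wedge G_0$, $\wedge G_1$ are those of these subspaces of $G_1$, $G_2$. The groupoid of 2-sectors has as objects the pairs $(a,b)$ of loops at the same object of $G$, on which the arrows of $G$ act by simultaneous conjugation; $e_1,e_2,e_{12}$ are its morphisms to $\wedge G$ given by $(a,b)\mapsto a,\ b,\ ab$. The involution $I:\wedge G\to\wedge G$ is $a\mapsto a^{-1}$, and $G\to\wedge G$, $x\mapsto 1_x$, is the untwisted sector. An *inner local system* (in the sense of Ruan) is a flat line bundle $L$ over $\wedge G$, that is, a family of flat line bundles $L_{(g)}$ over the sectors, for which there are 1. a trivialisation of $L_{(1)}$ over the untwisted sector, as a flat line bundle;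 2. a nondegenerate pairing $L\otimes I^*L\to\mathbf 1$, i.e. an isomorphism of flat line bundles over $\wedge G$; 3. a multiplication $\theta:e_1^*L\otimes e_2^*L\to e_{12}^*L$, an isomorphism of flat line bundles over the 2-sectors; 4. associativity: $\theta(\theta(\cdot,\cdot),\cdot)=\theta(\cdot,\theta(\cdot,\cdot))$ over all triples of loops at the same object. **Proposition.** Let $G$ be an orbifold and let $(h,A,B)$ be a gerbe with connection over $G$. Then the pair $$\rho(a,b)=\frac{h(a,b)}{h(b,\,b^{-1}ab)},\qquad \nabla=A|_{\wedge G_0}$$ is a line bundle with connection over the inertia groupoid $\wedge G$, it is flat, and it is an inner local system on the sectors of the orbifold. -/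

import Mathlib

open scoped Manifold ContDiff
open Diffeology

noncomputable section

namespace OrbifoldGerbe

universe u

/-- The test space `ℝⁿ`. -/
abbrev Eucl (n : ℕ) : Type := EuclideanSpace ℝ (Fin n)

/-! ## Smooth spaces

Objects, arrows, nerve and loop spaces of a smooth étale groupoid are handled uniformly as
diffeological spaces: a manifold carries its usual plots (smooth maps from `ℝᵏ`), products and
subsets carry the product and subset diffeology.  For a manifold, and for an embedded submanifold
(possibly with components of different dimensions, as is the case for the space of loops of an
orbifold), smooth functions and differential forms in this sense are the usual ones. -/

/-- The diffeology of a smooth `n`-manifold: plots are the smooth maps `ℝᵏ → M`. -/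
@[reducible]
def manifoldDiffeology (n : ℕ) (M : Type u) [TopologicalSpace M] [ChartedSpace (Eucl n) M] :
    DiffeologicalSpace M :=
  .ofCorePlotsOn {
    isPlotOn := fun {k u} _ p => ContMDiffOn 𝓘(ℝ, Eucl k) (𝓡 n) ∞ p u
    isPlotOn_congr := fun _ _ _ h => contMDiffOn_congr h
    isPlot := fun {k} p => ContMDiff 𝓘(ℝ, Eucl k) (𝓡 n) ∞ p
    isPlotOn_univ := contMDiffOn_univ
    isPlot_const := fun _ => contMDiff_const
    isPlotOn_reparam := fun _ _ _ h hp hf => hp.comp hf.contMDiffOn h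
    locality := fun _ _ h x hx => by
      obtain ⟨v, hv, hxv, hv'⟩ := h x hx
      exact ((hv' x hxv).contMDiffAt (hv.mem_nhds hxv)).contMDiffWithinAt }

/-- The subset diffeology: plots are the plots of the ambient space that land in the subset. -/
instance subtypeDiffeology {X : Type u} [DiffeologicalSpace X] (P : X → Prop) :
    DiffeologicalSpace {x // P x} where
  plots _ := {p | IsPlot fun y => (p y : X)}
  constant_plots x := isPlot_const (x := (x : X))
  plot_reparam hp hf := isPlot_reparam hp hf
  locality {n p} hp := DiffeologicalSpace.locality fun x => by
    obtain ⟨v, hv, hxv, h⟩ := hp x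
    exact ⟨v, hv, hxv, fun hf hf' => h hf hf'⟩

/-- The product diffeology: plots are the maps both of whose components are plots. -/
instance prodDiffeology {X Y : Type u} [DiffeologicalSpace X] [DiffeologicalSpace Y] :
    DiffeologicalSpace (X × Y) where
  plots _ := {p | (IsPlot fun y => (p y).1) ∧ IsPlot fun y => (p y).2}
  constant_plots x := ⟨isPlot_const (x := x.1), isPlot_const (x := x.2)⟩
  plot_reparam hp hf := ⟨isPlot_reparam hp.1 hf, isPlot_reparam hp.2 hf⟩
  locality {n p} hp := by
    refine ⟨DiffeologicalSpace.locality fun x => ?_, DiffeologicalSpace.locality fun x => ?_⟩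
    all_goals
      obtain ⟨v, hv, hxv, h⟩ := hp x
    · exact ⟨v, hv, hxv, fun hf hf' => (h hf hf').1⟩
    · exact ⟨v, hv, hxv, fun hf hf' => (h hf hf').2⟩

section Smoothness

variable {X Y Z : Type u} [DiffeologicalSpace X] [DiffeologicalSpace Y] [DiffeologicalSpace Z]

theorem dSmooth_val (P : X → Prop) : DSmooth (Subtype.val : {x // P x} → X) :=
  fun _ _ hp => hp

theorem dSmooth_fst : DSmooth (Prod.fst : X × Y → X) := fun _ _ hp => hp.1

theorem dSmooth_snd : DSmooth (Prod.snd : X × Y → Y) := fun _ _ hp => hp.2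

theorem dSmooth_mk {P : X → Prop} {f : Z → X} (hf : DSmooth f) (h : ∀ z, P (f z)) :
    DSmooth fun z => (⟨f z, h z⟩ : {x // P x}) :=
  fun n p hp => hf n p hp

theorem dSmooth_pair {f : Z → X} {g : Z → Y} (hf : DSmooth f) (hg : DSmooth g) :
    DSmooth fun z => (f z, g z) :=
  fun n p hp => ⟨hf n p hp, hg n p hp⟩

end Smoothness

/-! ## Differential forms and smooth functions to `ℂˣ` -/

/-- A complex-valued differential `k`-form on a diffeological space: a smooth `k`-form `p^*α` on
`ℝⁿ` for every plot `p : ℝⁿ → X`, compatible with smooth reparametrisation. -/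
@[ext]
structure DForm (k : ℕ) (X : Type u) [DiffeologicalSpace X] where
  onPlot : ∀ {n : ℕ} (p : Eucl n → X), IsPlot p → Eucl n → (Eucl n) [⋀^Fin k]→L[ℝ] ℂ
  smooth : ∀ {n : ℕ} (p : Eucl n → X) (hp : IsPlot p), ContDiff ℝ ∞ (onPlot p hp)
  reparam : ∀ {m n : ℕ} (p : Eucl n → X) (hp : IsPlot p) (f : Eucl m → Eucl n)
    (hf : ContDiff ℝ ∞ f) (y : Eucl m),
    onPlot (p ∘ f) (isPlot_reparam hp hf) y =
      (onPlot p hp (f y)).compContinuousLinearMap (fderiv ℝ f y)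

namespace DForm

variable {k : ℕ} {X Y : Type u} [DiffeologicalSpace X] [DiffeologicalSpace Y]

instance : Zero (DForm k X) where
  zero := ⟨fun _ _ _ => 0, fun _ _ => contDiff_const, fun _ _ _ _ _ => by ext; simp⟩

instance : Add (DForm k X) where
  add α β := ⟨fun p hp y => α.onPlot p hp y + β.onPlot p hp y,
    fun p hp => (α.smooth p hp).add (β.smooth p hp),
    fun p hp f hf y => by rw [α.reparam p hp f hf, β.reparam p hp f hf]; ext; simp⟩

instance : Sub (DForm k X) where
  sub α β := ⟨fun p hp y => α.onPlot p hp y - β.onPlot p hp y,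
    fun p hp => (α.smooth p hp).sub (β.smooth p hp),
    fun p hp f hf y => by rw [α.reparam p hp f hf, β.reparam p hp f hf]; ext; simp⟩

/-- The pullback `φ^*α` along a smooth map. -/
def pullback (φ : X → Y) (hφ : DSmooth φ) (α : DForm k Y) : DForm k X where
  onPlot p hp := α.onPlot (φ ∘ p) (hφ _ p hp)
  smooth _ _ := α.smooth _ _
  reparam p hp f hf y := α.reparam (φ ∘ p) (hφ _ p hp) f hf y

theorem onPlot_congr (α : DForm k X) {n : ℕ} {p q : Eucl n → X} (h : p = q) (hp : IsPlot p)
    (hq : IsPlot q) : α.onPlot p hp = α.onPlot q hq := by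
  subst h; rfl

/-- The exterior derivative, computed in plots. -/
def d (α : DForm k X) : DForm (k + 1) X where
  onPlot p hp := extDeriv (α.onPlot p hp)
  smooth p hp := by
    have h := (α.smooth p hp).fderiv_right (m := ∞) (by simp)
    exact (ContinuousAlternatingMap.alternatizeUncurryFinCLM ℝ _ ℂ).contDiff.comp h
  reparam p hp f hf y := by
    have h : α.onPlot (p ∘ f) (isPlot_reparam hp hf) =
        fun y => (α.onPlot p hp (f y)).compContinuousLinearMap (fderiv ℝ f y) :=
      funext fun y => α.reparam p hp f hf y
    rw [h]
    exact extDeriv_pullback ((α.smooth p hp).differentiable (by simp) _) hf.contDiffAt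
      (by simpa using WithTop.coe_le_coe.2 (le_top (a := (2 : ℕ∞))))

end DForm

/-- A smooth function `X → ℂˣ`. -/
@[ext]
structure SmoothUnit (X : Type u) [DiffeologicalSpace X] where
  toFun : X → ℂˣ
  smooth : ∀ {n : ℕ} (p : Eucl n → X), IsPlot p → ContDiff ℝ ∞ fun y => (toFun (p y) : ℂ)

namespace SmoothUnit

variable {X Y : Type u} [DiffeologicalSpace X] [DiffeologicalSpace Y]

instance : CoeFun (SmoothUnit X) fun _ => X → ℂˣ := ⟨toFun⟩

instance : One (SmoothUnit X) where
  one := ⟨fun _ => 1, fun _ _ => contDiff_const⟩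

instance : Mul (SmoothUnit X) where
  mul f g := ⟨fun x => f x * g x, fun p hp => by
    simpa using (f.smooth p hp).mul (g.smooth p hp)⟩

/-- The pullback `f ∘ φ` along a smooth map. -/
def pullback (φ : X → Y) (hφ : DSmooth φ) (f : SmoothUnit Y) : SmoothUnit X where
  toFun x := f (φ x)
  smooth p hp := f.smooth (φ ∘ p) (hφ _ p hp)

/-- The logarithmic differential `d log f = f⁻¹ df`. -/
def dlog (f : SmoothUnit X) : DForm 1 X where
  onPlot {n} p _ y := ContinuousAlternatingMap.ofSubsingleton ℝ (Eucl n) ℂ (0 : Fin 1)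
    ((f (p y) : ℂ)⁻¹ • fderiv ℝ (fun z => (f (p z) : ℂ)) y)
  smooth {n} p hp := by
    have h : ContDiff ℝ ∞ fun L : Eucl n →L[ℝ] ℂ =>
        ContinuousAlternatingMap.ofSubsingleton ℝ (Eucl n) ℂ (0 : Fin 1) L :=
      LinearIsometryEquiv.contDiff (E := Eucl n →L[ℝ] ℂ) (F := (Eucl n) [⋀^Fin 1]→L[ℝ] ℂ)
        (ContinuousAlternatingMap.ofSubsingletonLIE (𝕜 := ℝ) (E := Eucl n) (F := ℂ) (0 : Fin 1))
    refine h.comp ?_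
    exact ((f.smooth p hp).inv fun y => (f (p y)).ne_zero).smul
      ((f.smooth p hp).fderiv_right (m := ∞) (by simp))
  reparam p hp g hg y := by
    have h : fderiv ℝ (fun z => (f ((p ∘ g) z) : ℂ)) y =
        (fderiv ℝ (fun z => (f (p z) : ℂ)) (g y)).comp (fderiv ℝ g y) :=
      fderiv_comp (g := fun z => (f (p z) : ℂ)) y
        ((f.smooth p hp).differentiable (by simp) _) (hg.differentiable (by simp) _)
    rw [h]
    ext v
    simp [Function.comp_def]

theorem dlog_mul (f g : SmoothUnit X) : (f * g).dlog = f.dlog + g.dlog := by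
  refine DForm.ext ?_
  funext n p hp y
  ext v
  have hf := ((f.smooth p hp).differentiable (by simp) y).hasFDerivAt
  have hg := ((g.smooth p hp).differentiable (by simp) y).hasFDerivAt
  have h : fderiv ℝ (fun z => ((f * g) (p z) : ℂ)) y = _ := (hf.mul hg).fderiv
  have h1 := (f (p y)).ne_zero
  have h2 := (g (p y)).ne_zero
  change (((f (p y) * g (p y) : ℂˣ) : ℂ)⁻¹ • fderiv ℝ (fun z => ((f * g) (p z) : ℂ)) y) (v 0) =
    ((f (p y) : ℂ)⁻¹ • fderiv ℝ (fun z => (f (p z) : ℂ)) y) (v 0) +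
      ((g (p y) : ℂ)⁻¹ • fderiv ℝ (fun z => (g (p z) : ℂ)) y) (v 0)
  rw [h]
  simp
  field_simp
  ring

end SmoothUnit

/-! ## Groupoids -/

/-- A smooth groupoid: spaces of objects and arrows with smooth structure maps.  The composite
`comp (g, h)` of `g : x ⟶ y` and `h : y ⟶ z` is defined when `tgt g = src h`
and written `gh` (diagrammatic order). -/
structure SmoothGroupoid where
  Obj : Type u
  Arr : Type u
  [objDiffeology : DiffeologicalSpace Obj]
  [arrDiffeology : DiffeologicalSpace Arr]
  src : Arr → Obj
  tgt : Arr → Obj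
  one : Obj → Arr
  inv : Arr → Arr
  comp : {w : Arr × Arr // tgt w.1 = src w.2} → Arr
  src_smooth : DSmooth src
  tgt_smooth : DSmooth tgt
  one_smooth : DSmooth one
  inv_smooth : DSmooth inv
  comp_smooth : DSmooth comp
  src_one : ∀ x, src (one x) = x
  tgt_one : ∀ x, tgt (one x) = x
  src_inv : ∀ g, src (inv g) = tgt g
  tgt_inv : ∀ g, tgt (inv g) = src g
  src_comp : ∀ w, src (comp w) = src w.1.1
  tgt_comp : ∀ w, tgt (comp w) = tgt w.1.2
  one_comp : ∀ g, comp ⟨(one (src g), g), tgt_one _⟩ = g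
  comp_one : ∀ g, comp ⟨(g, one (tgt g)), (src_one _).symm⟩ = g
  inv_comp : ∀ g, comp ⟨(inv g, g), tgt_inv g⟩ = one (tgt g)
  comp_inv : ∀ g, comp ⟨(g, inv g), (src_inv g).symm⟩ = one (src g)
  assoc : ∀ (g h k : Arr) (hgh : tgt g = src h) (hhk : tgt h = src k),
    comp ⟨(comp ⟨(g, h), hgh⟩, k), (tgt_comp _).trans hhk⟩ =
      comp ⟨(g, comp ⟨(h, k), hhk⟩), hgh.trans (src_comp ⟨(h, k), hhk⟩).symm⟩

attribute [instance] SmoothGroupoid.objDiffeology SmoothGroupoid.arrDiffeology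

namespace SmoothGroupoid

variable (G : SmoothGroupoid.{u})

/-- The space `G₂` of composable pairs of arrows. -/
abbrev Pairs : Type u := {w : G.Arr × G.Arr // G.tgt w.1 = G.src w.2}

variable {G}

/-- The product `gh` of composable arrows. -/
abbrev mul (g h : G.Arr) (hgh : G.tgt g = G.src h) : G.Arr := G.comp ⟨(g, h), hgh⟩

theorem mul_congr {g g' h h' : G.Arr} (hg : g = g') (hh : h = h') (w : G.tgt g = G.src h)
    (w' : G.tgt g' = G.src h') : mul g h w = mul g' h' w' := by
  subst hg hh; rfl

theorem dSmooth_mul {Z : Type u} [DiffeologicalSpace Z] {f g : Z → G.Arr} (hf : DSmooth f)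
    (hg : DSmooth g) (w : ∀ z, G.tgt (f z) = G.src (g z)) :
    DSmooth fun z => mul (f z) (g z) (w z) :=
  G.comp_smooth.comp (dSmooth_mk (dSmooth_pair hf hg) w)

theorem inv_one (x : G.Obj) : G.inv (G.one x) = G.one x := by
  have h := G.inv_comp (G.one x)
  have e : G.tgt (G.inv (G.one x)) = x := by rw [G.tgt_inv, G.src_one]
  rw [← G.comp_one (G.inv (G.one x))]
  rw [G.tgt_one] at h
  exact (mul_congr rfl (by rw [e]) _ _).trans h

theorem inv_mul_cancel_left (g h : G.Arr) (w : G.tgt g = G.src h) :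
    mul (G.inv g) (mul g h w) (by rw [G.tgt_inv, G.src_comp]) = h := by
  rw [mul, ← G.assoc (G.inv g) g h (G.tgt_inv g) w]
  exact (mul_congr ((G.inv_comp g).trans (by rw [w])) rfl _ _).trans (G.one_comp h)

theorem mul_inv_cancel_left (g h : G.Arr) (w : G.src g = G.src h) :
    mul g (mul (G.inv g) h (by rw [G.tgt_inv, w])) (by rw [G.src_comp, G.src_inv]) = h := by
  rw [mul, ← G.assoc g (G.inv g) h (G.src_inv g).symm (by rw [G.tgt_inv, w])]
  exact (mul_congr ((G.comp_inv g).trans (by rw [w])) rfl _ _).trans (G.one_comp h)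

end SmoothGroupoid

/-- An orbifold of dimension `n`: a proper étale smooth groupoid.  Objects and arrows are smooth
Hausdorff `n`-manifolds, source and target are local diffeomorphisms (hence so are the other
structure maps, which are smooth), and `(s, t) : G₁ → G₀ × G₀` is proper. -/
structure Orbifold (n : ℕ) (G : SmoothGroupoid.{u}) where
  [objTop : TopologicalSpace G.Obj]
  [arrTop : TopologicalSpace G.Arr]
  [objT2 : T2Space G.Obj]
  [arrT2 : T2Space G.Arr]
  [objCharts : ChartedSpace (Eucl n) G.Obj]
  [arrCharts : ChartedSpace (Eucl n) G.Arr]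
  [objManifold : IsManifold (𝓡 n) ∞ G.Obj]
  [arrManifold : IsManifold (𝓡 n) ∞ G.Arr]
  obj_diffeology : G.objDiffeology = manifoldDiffeology n G.Obj
  arr_diffeology : G.arrDiffeology = manifoldDiffeology n G.Arr
  src_etale : IsLocalDiffeomorph (𝓡 n) (𝓡 n) ∞ G.src
  tgt_etale : IsLocalDiffeomorph (𝓡 n) (𝓡 n) ∞ G.tgt
  isProper : IsProperMap fun g : G.Arr => (G.src g, G.tgt g)

/-- A smooth morphism of groupoids. -/
structure GroupoidHom (G H : SmoothGroupoid.{u}) where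
  obj : G.Obj → H.Obj
  arr : G.Arr → H.Arr
  obj_smooth : DSmooth obj
  arr_smooth : DSmooth arr
  src_arr : ∀ g, H.src (arr g) = obj (G.src g)
  tgt_arr : ∀ g, H.tgt (arr g) = obj (G.tgt g)
  arr_mul : ∀ (g h : G.Arr) (w : G.tgt g = G.src h),
    arr (G.mul g h w) = H.mul (arr g) (arr h) (by rw [tgt_arr, src_arr, w])

/-- A smooth right action of a groupoid on a space over its objects. -/
structure RightSpace (G : SmoothGroupoid.{u}) where
  carrier : Type u
  [diffeology : DiffeologicalSpace carrier]
  anchor : carrier → G.Obj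
  act : {w : carrier × G.Arr // anchor w.1 = G.src w.2} → carrier
  anchor_smooth : DSmooth anchor
  act_smooth : DSmooth act
  anchor_act : ∀ w, anchor (act w) = G.tgt w.1.2
  act_one : ∀ z, act ⟨(z, G.one (anchor z)), (G.src_one _).symm⟩ = z
  act_mul : ∀ (z : carrier) (g h : G.Arr) (hg : anchor z = G.src g) (hgh : G.tgt g = G.src h),
    act ⟨(act ⟨(z, g), hg⟩, h), (anchor_act _).trans hgh⟩ =
      act ⟨(z, G.mul g h hgh), hg.trans (G.src_comp ⟨(g, h), hgh⟩).symm⟩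

attribute [instance] RightSpace.diffeology

namespace RightSpace

variable {G : SmoothGroupoid.{u}}

theorem act_congr (Z : RightSpace G) {z z' : Z.carrier} {g g' : G.Arr} (hz : z = z') (hg : g = g')
    (w : Z.anchor z = G.src g) (w' : Z.anchor z' = G.src g') :
    Z.act ⟨(z, g), w⟩ = Z.act ⟨(z', g'), w'⟩ := by
  subst hz hg; rfl

/-- The arrows `(z, g) : z ⟶ z · g` of the action groupoid. -/
abbrev Arrow (Z : RightSpace G) : Type u := {w : Z.carrier × G.Arr // Z.anchor w.1 = G.src w.2}

theorem arrow_comp (Z : RightSpace G) (v : {v : Z.Arrow × Z.Arrow // Z.act v.1 = v.2.1.1}) :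
    G.tgt v.1.1.1.2 = G.src v.1.2.1.2 := by
  rw [← Z.anchor_act v.1.1, v.2]; exact v.1.2.2

theorem arrow_anchor (Z : RightSpace G) (v : {v : Z.Arrow × Z.Arrow // Z.act v.1 = v.2.1.1}) :
    Z.anchor v.1.1.1.1 = G.src (G.mul v.1.1.1.2 v.1.2.1.2 (Z.arrow_comp v)) := by
  rw [G.src_comp]; exact v.1.1.2

theorem arrow_inv (Z : RightSpace G) (w : Z.Arrow) : Z.anchor (Z.act w) = G.src (G.inv w.1.2) := by
  rw [Z.anchor_act, G.src_inv]

/-- The action groupoid `Z ⋊ G`: an arrow `(z, g)` goes from `z` to `z · g`. -/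
abbrev groupoid (Z : RightSpace G) : SmoothGroupoid.{u} where
  Obj := Z.carrier
  Arr := Z.Arrow
  src w := w.1.1
  tgt w := Z.act w
  one z := ⟨(z, G.one (Z.anchor z)), (G.src_one _).symm⟩
  inv w := ⟨(Z.act w, G.inv w.1.2), Z.arrow_inv w⟩
  comp v := ⟨(v.1.1.1.1, G.mul v.1.1.1.2 v.1.2.1.2 (Z.arrow_comp v)), Z.arrow_anchor v⟩
  src_smooth := dSmooth_fst.comp (dSmooth_val _)
  tgt_smooth := Z.act_smooth
  one_smooth := dSmooth_mk (dSmooth_pair dSmooth_id (G.one_smooth.comp Z.anchor_smooth)) _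
  inv_smooth := dSmooth_mk (dSmooth_pair Z.act_smooth
    (G.inv_smooth.comp (dSmooth_snd.comp (dSmooth_val _)))) Z.arrow_inv
  comp_smooth := dSmooth_mk (dSmooth_pair
    (dSmooth_fst.comp ((dSmooth_val _).comp (dSmooth_fst.comp (dSmooth_val _))))
    (SmoothGroupoid.dSmooth_mul
      (dSmooth_snd.comp ((dSmooth_val _).comp (dSmooth_fst.comp (dSmooth_val _))))
      (dSmooth_snd.comp ((dSmooth_val _).comp (dSmooth_snd.comp (dSmooth_val _))))
      Z.arrow_comp)) Z.arrow_anchor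
  src_one _ := rfl
  tgt_one := Z.act_one
  src_inv _ := rfl
  tgt_inv w := (Z.act_mul w.1.1 w.1.2 (G.inv w.1.2) w.2 (G.src_inv _).symm).trans
    ((Z.act_congr rfl ((G.comp_inv _).trans (congrArg G.one w.2.symm)) _ _).trans (Z.act_one _))
  src_comp _ := rfl
  tgt_comp v := (Z.act_mul v.1.1.1.1 v.1.1.1.2 v.1.2.1.2 v.1.1.2 (Z.arrow_comp v)).symm.trans
    (Z.act_congr v.2 rfl _ _)
  one_comp w := Subtype.ext (Prod.ext rfl
    ((SmoothGroupoid.mul_congr (congrArg G.one w.2) rfl _ _).trans (G.one_comp w.1.2)))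
  comp_one w := Subtype.ext (Prod.ext rfl
    ((SmoothGroupoid.mul_congr rfl (congrArg G.one (Z.anchor_act w)) _ _).trans
      (G.comp_one w.1.2)))
  inv_comp w := Subtype.ext (Prod.ext rfl
    ((G.inv_comp w.1.2).trans (congrArg G.one (Z.anchor_act w)).symm))
  comp_inv w := Subtype.ext (Prod.ext rfl
    ((G.comp_inv w.1.2).trans (congrArg G.one w.2.symm)))
  assoc _ _ _ _ _ := Subtype.ext (Prod.ext rfl (G.assoc _ _ _ _ _))

/-- A smooth equivariant map of right `G`-spaces induces a morphism of action groupoids. -/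
def mapGroupoid {Z W : RightSpace G} (f : Z.carrier → W.carrier) (hf : DSmooth f)
    (hanchor : ∀ z, W.anchor (f z) = Z.anchor z)
    (hact : ∀ (z : Z.carrier) (g : G.Arr) (w : Z.anchor z = G.src g),
      W.act ⟨(f z, g), (hanchor z).trans w⟩ = f (Z.act ⟨(z, g), w⟩)) :
    GroupoidHom Z.groupoid W.groupoid where
  obj := f
  arr w := ⟨(f w.1.1, w.1.2), (hanchor _).trans w.2⟩
  obj_smooth := hf
  arr_smooth := dSmooth_mk (dSmooth_pair (hf.comp (dSmooth_fst.comp (dSmooth_val _)))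
    (dSmooth_snd.comp (dSmooth_val _))) _
  src_arr _ := rfl
  tgt_arr w := hact w.1.1 w.1.2 w.2
  arr_mul _ _ _ := rfl

end RightSpace

/-! ## Inertia groupoid and 2-sectors -/

namespace SmoothGroupoid

variable {G : SmoothGroupoid.{u}}

theorem mul_left_cancel {g h h' : G.Arr} (w : G.tgt g = G.src h) (w' : G.tgt g = G.src h')
    (e : mul g h w = mul g h' w') : h = h' := by
  exact (inv_mul_cancel_left g h w).symm.trans
    ((mul_congr rfl e _ _).trans (inv_mul_cancel_left g h' w'))

/-- The conjugate `b⁻¹ a b` of a loop `a` by an arrow `b`. -/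
def conj (a b : G.Arr) (ha : G.src a = G.tgt a) (hab : G.tgt a = G.src b) : G.Arr :=
  mul (G.inv b) (mul a b hab) (by rw [G.tgt_inv, G.src_comp, ← hab, ha])

section Conj

variable (a b : G.Arr) (ha : G.src a = G.tgt a) (hab : G.tgt a = G.src b)

theorem src_conj : G.src (conj a b ha hab) = G.tgt b := by
  rw [conj, mul, G.src_comp, G.src_inv]

theorem tgt_conj : G.tgt (conj a b ha hab) = G.tgt b := by
  exact (G.tgt_comp _).trans (G.tgt_comp _)

theorem conj_loop : G.src (conj a b ha hab) = G.tgt (conj a b ha hab) := by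
  rw [src_conj, tgt_conj]

theorem mul_conj : mul b (conj a b ha hab) (src_conj a b ha hab).symm = mul a b hab :=
  mul_inv_cancel_left b (mul a b hab) (by rw [G.src_comp, ha, hab])

theorem eq_conj (c : G.Arr) (w : G.tgt b = G.src c) (e : mul b c w = mul a b hab) :
    c = conj a b ha hab :=
  mul_left_cancel w (src_conj a b ha hab).symm (e.trans (mul_conj a b ha hab).symm)

theorem conj_congr {a a' b b' : G.Arr} (ea : a = a') (eb : b = b') (ha : G.src a = G.tgt a)
    (hab : G.tgt a = G.src b) (ha' : G.src a' = G.tgt a') (hab' : G.tgt a' = G.src b') :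
    conj a b ha hab = conj a' b' ha' hab' := by
  subst ea eb; rfl

theorem conj_one : conj a (G.one (G.tgt a)) ha (G.src_one _).symm = a := by
  refine (eq_conj a _ ha _ a (by rw [G.tgt_one, ha]) ?_).symm
  refine Eq.trans ?_ (G.comp_one a).symm
  exact (mul_congr (congrArg G.one ha.symm) rfl _ _).trans (G.one_comp a)

theorem conj_conj (c : G.Arr) (hbc : G.tgt b = G.src c) :
    conj (conj a b ha hab) c (conj_loop a b ha hab) ((tgt_conj a b ha hab).trans hbc) =
      conj a (mul b c hbc) ha (hab.trans (G.src_comp ⟨(b, c), hbc⟩).symm) := by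
  have h1 := mul_conj a b ha hab
  have h2 := mul_conj (conj a b ha hab) c (conj_loop a b ha hab) ((tgt_conj a b ha hab).trans hbc)
  refine eq_conj a (mul b c hbc) ha _ _ (by rw [G.tgt_comp, src_conj]) ?_
  rw [mul, G.assoc b c _ hbc (src_conj _ _ _ _).symm]
  refine (mul_congr rfl h2 _ (by rw [G.src_comp, src_conj])).trans ?_
  rw [mul, ← G.assoc b (conj a b ha hab) c (src_conj a b ha hab).symm
    ((tgt_conj a b ha hab).trans hbc)]
  refine (mul_congr h1 rfl _ (by rw [G.tgt_comp, hbc])).trans ?_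
  exact G.assoc a b c hab hbc

theorem conj_mul (a' : G.Arr) (ha' : G.src a' = G.tgt a') (haa' : G.tgt a = G.src a') :
    mul (conj a b ha hab) (conj a' b ha' (by rw [← ha', ← haa', hab]))
        (by rw [tgt_conj, src_conj]) =
      conj (mul a a' haa') b (by rw [G.src_comp, G.tgt_comp, ha, haa', ha'])
        (by rw [G.tgt_comp, ← ha', ← haa', hab]) := by
  have hab' : G.tgt a' = G.src b := by rw [← ha', ← haa', hab]
  have h1 := mul_conj a b ha hab
  have h2 := mul_conj a' b ha' hab'
  refine eq_conj _ b _ _ _ (by rw [G.src_comp, src_conj]) ?_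
  rw [mul, ← G.assoc b (conj a b ha hab) (conj a' b ha' hab') (src_conj _ _ _ _).symm
    (by rw [tgt_conj, src_conj])]
  refine (mul_congr h1 rfl _ (by rw [G.tgt_comp, src_conj])).trans ?_
  rw [mul, G.assoc a b (conj a' b ha' hab') hab (src_conj _ _ _ _).symm]
  refine (mul_congr rfl h2 _ (by rw [G.src_comp, haa'])).trans ?_
  exact (G.assoc a a' b haa' hab').symm

theorem conj_of_one : conj (G.one (G.src b)) b (by rw [G.src_one, G.tgt_one]) (G.tgt_one _) =
    G.one (G.tgt b) := by
  refine (eq_conj _ b _ _ _ (G.src_one _).symm ?_).symm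
  exact (G.comp_one b).trans (G.one_comp b).symm

theorem conj_inv : conj (G.inv a) b (by rw [G.src_inv, G.tgt_inv, ha])
    (by rw [G.tgt_inv, ha, hab]) = G.inv (conj a b ha hab) := by
  have hl : G.src (G.inv a) = G.tgt (G.inv a) := by rw [G.src_inv, G.tgt_inv, ha]
  have hb : G.tgt (G.inv a) = G.src b := by rw [G.tgt_inv, ha, hab]
  refine mul_left_cancel (g := conj a b ha hab) (by rw [tgt_conj, src_conj])
    (by rw [G.src_inv]) ?_
  refine (conj_mul a b ha hab (G.inv a) hl (G.src_inv a).symm).trans ?_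
  refine (conj_congr ((G.comp_inv a).trans (congrArg G.one (ha.trans hab))) rfl _ _
    (by rw [G.src_one, G.tgt_one]) (G.tgt_one _)).trans ?_
  refine (conj_of_one b).trans ?_
  exact ((G.comp_inv _).trans (congrArg G.one (src_conj a b ha hab))).symm

end Conj

theorem dSmooth_conj {Z : Type u} [DiffeologicalSpace Z] {f g : Z → G.Arr} (hf : DSmooth f)
    (hg : DSmooth g) (h1 : ∀ z, G.src (f z) = G.tgt (f z)) (h2 : ∀ z, G.tgt (f z) = G.src (g z)) :
    DSmooth fun z => conj (f z) (g z) (h1 z) (h2 z) :=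
  dSmooth_mul (G.inv_smooth.comp hg) (dSmooth_mul hf hg h2) _

variable (G)

/-- The space of loops `∧G₀ = {a ∈ G₁ | s(a) = t(a)}`. -/
abbrev Loop : Type u := {a : G.Arr // G.src a = G.tgt a}

/-- The space of pairs of loops at the same object. -/
abbrev LoopPair : Type u :=
  {w : G.Arr × G.Arr // (G.src w.1 = G.tgt w.1 ∧ G.src w.2 = G.tgt w.2) ∧ G.tgt w.1 = G.src w.2}

/-- The constant loop `1ₓ`. -/
abbrev oneLoop (x : G.Obj) : G.Loop := ⟨G.one x, (G.src_one x).trans (G.tgt_one x).symm⟩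

variable {G} in
/-- The inverse loop `a⁻¹`. -/
abbrev invLoop (a : G.Loop) : G.Loop :=
  ⟨G.inv a.1, (G.src_inv a.1).trans (a.2.symm.trans (G.tgt_inv a.1).symm)⟩

theorem dSmooth_oneLoop : DSmooth G.oneLoop := fun n p hp => G.one_smooth n p hp

theorem dSmooth_invLoop : DSmooth (invLoop (G := G)) :=
  fun n p hp => G.inv_smooth n (fun y => (p y).1) hp

variable {G} in
/-- The product `ab` of loops at the same object. -/
abbrev loopMul (a b : G.Loop) (hab : G.tgt a.1 = G.src b.1) : G.Loop :=
  ⟨mul a.1 b.1 hab, by rw [G.src_comp, G.tgt_comp, a.2, hab, b.2]⟩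

variable {G} in
/-- The pair `(a, b)` of loops at the same object. -/
abbrev loopPair (a b : G.Loop) (hab : G.tgt a.1 = G.src b.1) : G.LoopPair :=
  ⟨(a.1, b.1), ⟨a.2, b.2⟩, hab⟩

/-- The loops with the conjugation action `a · b = b⁻¹ a b`. -/
abbrev loopSpace : RightSpace G where
  carrier := G.Loop
  anchor a := G.tgt a.1
  act w := ⟨conj w.1.1.1 w.1.2 w.1.1.2 w.2, conj_loop w.1.1.1 w.1.2 w.1.1.2 w.2⟩
  anchor_smooth := G.tgt_smooth.comp (dSmooth_val _)
  act_smooth := dSmooth_mk (dSmooth_conj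
    ((dSmooth_val _).comp (dSmooth_fst.comp (dSmooth_val _)))
    (dSmooth_snd.comp (dSmooth_val _)) _ _) _
  anchor_act w := tgt_conj w.1.1.1 w.1.2 w.1.1.2 w.2
  act_one a := Subtype.ext (conj_one a.1 a.2)
  act_mul a g h hg hgh := Subtype.ext (conj_conj a.1 g a.2 hg h hgh)

theorem loopPair_snd {w : G.LoopPair} {b : G.Arr} (h : G.tgt w.1.1 = G.src b) :
    G.tgt w.1.2 = G.src b := (w.2.2.trans w.2.1.2).symm.trans h

variable {G} in
/-- Simultaneous conjugation of a pair of loops. -/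
abbrev loopPairAct (w : G.LoopPair) (b : G.Arr) (h : G.tgt w.1.1 = G.src b) : G.LoopPair :=
  ⟨(conj w.1.1 b w.2.1.1 h, conj w.1.2 b w.2.1.2 (G.loopPair_snd h)),
    ⟨conj_loop w.1.1 b w.2.1.1 h, conj_loop w.1.2 b w.2.1.2 (G.loopPair_snd h)⟩,
    (tgt_conj w.1.1 b w.2.1.1 h).trans (src_conj w.1.2 b w.2.1.2 (G.loopPair_snd h)).symm⟩

/-- The pairs of loops at the same object with the simultaneous conjugation action. -/
abbrev loopPairSpace : RightSpace G where
  carrier := G.LoopPair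
  anchor w := G.tgt w.1.1
  act w := loopPairAct w.1.1 w.1.2 w.2
  anchor_smooth := G.tgt_smooth.comp (dSmooth_fst.comp (dSmooth_val _))
  act_smooth := dSmooth_mk (dSmooth_pair
    (dSmooth_conj (dSmooth_fst.comp ((dSmooth_val _).comp (dSmooth_fst.comp (dSmooth_val _))))
      (dSmooth_snd.comp (dSmooth_val _)) _ _)
    (dSmooth_conj (dSmooth_snd.comp ((dSmooth_val _).comp (dSmooth_fst.comp (dSmooth_val _))))
      (dSmooth_snd.comp (dSmooth_val _)) _ _)) _
  anchor_act w := tgt_conj w.1.1.1.1 w.1.2 w.1.1.2.1.1 w.2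
  act_one z := Subtype.ext (Prod.ext (conj_one z.1.1 z.2.1.1)
    ((conj_congr rfl (congrArg G.one (z.2.2.trans z.2.1.2)) z.2.1.2 _ z.2.1.2
      (G.src_one _).symm).trans (conj_one z.1.2 z.2.1.2)))
  act_mul z g h hg hgh := Subtype.ext (Prod.ext
    (conj_conj z.1.1 g z.2.1.1 hg h hgh)
    (conj_conj z.1.2 g z.2.1.2 (((z.2.2.trans z.2.1.2).symm).trans hg) h hgh))

/-- The inertia groupoid `∧G`: objects are the loops `a` of `G`, arrows are the pairs
`(a, b)` in `G₂` with `a` a loop, with source `a` and target `b⁻¹ a b`.  It represents the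
disjoint union of all the sectors. -/
abbrev inertia : SmoothGroupoid.{u} := G.loopSpace.groupoid

/-- The groupoid of 2-sectors: objects are the pairs of loops at the same object of `G`,
and the arrows of `G` act by simultaneous conjugation. -/
abbrev twoSectors : SmoothGroupoid.{u} := G.loopPairSpace.groupoid

/-- The inclusion `G → ∧G` of the untwisted sector, `x ↦ 1ₓ`. -/
def untwisted : GroupoidHom G G.inertia where
  obj := G.oneLoop
  arr g := ⟨(G.oneLoop (G.src g), g), G.tgt_one _⟩
  obj_smooth := G.dSmooth_oneLoop
  arr_smooth := dSmooth_mk (dSmooth_pair (G.dSmooth_oneLoop.comp G.src_smooth) dSmooth_id) _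
  src_arr _ := rfl
  tgt_arr g := Subtype.ext (conj_of_one g)
  arr_mul _ _ _ := Subtype.ext (Prod.ext (congrArg G.oneLoop (G.src_comp _)) rfl)

/-- The involution `I : ∧G → ∧G`, `a ↦ a⁻¹`. -/
def involution : GroupoidHom G.inertia G.inertia :=
  RightSpace.mapGroupoid (Z := G.loopSpace) (W := G.loopSpace) invLoop G.dSmooth_invLoop
    (fun a : G.Loop => (G.tgt_inv _).trans a.2)
    (fun (a : G.Loop) b w => Subtype.ext (conj_inv a.1 b a.2 w))

/-- The evaluation map `e₁ : (a, b) ↦ a`. -/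
def evalFst : GroupoidHom G.twoSectors G.inertia :=
  RightSpace.mapGroupoid (Z := G.loopPairSpace) (W := G.loopSpace)
    (fun w : G.LoopPair => (⟨w.1.1, w.2.1.1⟩ : G.Loop))
    (dSmooth_mk (dSmooth_fst.comp (dSmooth_val _)) _) (fun _ => rfl) (fun _ _ _ => rfl)

/-- The evaluation map `e₂ : (a, b) ↦ b`. -/
def evalSnd : GroupoidHom G.twoSectors G.inertia :=
  RightSpace.mapGroupoid (Z := G.loopPairSpace) (W := G.loopSpace)
    (fun w : G.LoopPair => (⟨w.1.2, w.2.1.2⟩ : G.Loop))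
    (dSmooth_mk (dSmooth_snd.comp (dSmooth_val _)) _)
    (fun w : G.LoopPair => (w.2.2.trans w.2.1.2).symm) (fun _ _ _ => rfl)

/-- The evaluation map `e₁₂ : (a, b) ↦ ab`. -/
def evalMul : GroupoidHom G.twoSectors G.inertia :=
  RightSpace.mapGroupoid (Z := G.loopPairSpace) (W := G.loopSpace)
    (fun w : G.LoopPair => loopMul ⟨w.1.1, w.2.1.1⟩ ⟨w.1.2, w.2.1.2⟩ w.2.2)
    (dSmooth_mk (dSmooth_mul (dSmooth_fst.comp (dSmooth_val _))
      (dSmooth_snd.comp (dSmooth_val _)) _) _)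
    (fun w : G.LoopPair => (G.tgt_comp _).trans (w.2.2.trans w.2.1.2).symm)
    (fun (w : G.LoopPair) b h => Subtype.ext (conj_mul w.1.1 b w.2.1.1 h w.1.2 w.2.1.2 w.2.2).symm)

end SmoothGroupoid

/-! ## Line bundles with connection and gerbes with connection -/

/-- A line bundle with connection over a groupoid: a morphism of groupoids
`ρ : G → (ℂˣ ⇉ *)`, i.e. an action of the arrows on the trivial line over the objects, and a
1-form `A` on the objects (the connection `d + A`) with `s^*A - t^*A = d log ρ`. -/
structure LineBundle (G : SmoothGroupoid.{u}) where
  ρ : SmoothUnit G.Arr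
  A : DForm 1 G.Obj
  ρ_mul : ∀ (g h : G.Arr) (w : G.tgt g = G.src h), ρ (G.mul g h w) = ρ g * ρ h
  conn : A.pullback G.src G.src_smooth - A.pullback G.tgt G.tgt_smooth = ρ.dlog

namespace LineBundle

variable {G H : SmoothGroupoid.{u}}

/-- The line bundle is flat: the curvature `dA` vanishes. -/
def IsFlat (L : LineBundle G) : Prop := L.A.d = 0

/-- The trivial line bundle with trivial connection. -/
def trivial (G : SmoothGroupoid.{u}) : LineBundle G where
  ρ := 1
  A := 0
  ρ_mul _ _ _ := (one_mul (1 : ℂˣ)).symm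
  conn := by
    refine DForm.ext ?_
    funext n p hp y
    ext v
    change (0 : ℂ) - 0 = ((1 : ℂ)⁻¹ • fderiv ℝ (fun _ => (1 : ℂ)) y) (v 0)
    simp

/-- The tensor product of line bundles with connection. -/
def tensor (L M : LineBundle G) : LineBundle G where
  ρ := L.ρ * M.ρ
  A := L.A + M.A
  ρ_mul g h w := by
    change L.ρ _ * M.ρ _ = (L.ρ g * M.ρ g) * (L.ρ h * M.ρ h)
    rw [L.ρ_mul, M.ρ_mul, mul_mul_mul_comm]
  conn := by
    rw [SmoothUnit.dlog_mul, ← L.conn, ← M.conn]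
    refine DForm.ext ?_
    funext n p hp y
    exact add_sub_add_comm _ _ _ _

/-- The pullback of a line bundle with connection along a morphism of groupoids. -/
def pullback (φ : GroupoidHom G H) (L : LineBundle H) : LineBundle G where
  ρ := L.ρ.pullback φ.arr φ.arr_smooth
  A := L.A.pullback φ.obj φ.obj_smooth
  ρ_mul g h w := by
    change L.ρ (φ.arr _) = L.ρ (φ.arr g) * L.ρ (φ.arr h)
    rw [φ.arr_mul, L.ρ_mul]
  conn := by
    have e : (L.ρ.pullback φ.arr φ.arr_smooth).dlog = L.ρ.dlog.pullback φ.arr φ.arr_smooth := rfl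
    have hs : H.src ∘ φ.arr = φ.obj ∘ G.src := funext φ.src_arr
    have ht : H.tgt ∘ φ.arr = φ.obj ∘ G.tgt := funext φ.tgt_arr
    rw [e, ← L.conn]
    refine DForm.ext ?_
    funext n p hp y
    refine congrArg₂ (· - ·) ?_ ?_
    · exact congrFun (L.A.onPlot_congr (by rw [← Function.comp_assoc, ← hs]; rfl) _ _) y
    · exact congrFun (L.A.onPlot_congr (by rw [← Function.comp_assoc, ← ht]; rfl) _ _) y

/-- An isomorphism of line bundles with connection: multiplication by a smooth nowhere vanishing
function on the objects that is equivariant and parallel. -/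
structure Iso (L M : LineBundle G) where
  f : SmoothUnit G.Obj
  equivariant : ∀ g : G.Arr, f (G.tgt g) * L.ρ g = M.ρ g * f (G.src g)
  parallel : L.A - M.A = f.dlog

end LineBundle

/-- A gerbe with connection: a 2-cocycle `(h, A, B)` of the Čech complex of
`ℂˣ → 𝒜¹ → 𝒜²`, i.e. `δB = dA`, `δA = d log h` and `δh = 1`, where
`δB = s^*B - t^*B`, `(δA)(a, b) = A(b) - A(ab) + A(a)` and
`(δh)(a, b, c) = h(b, c) h(ab, c)⁻¹ h(a, bc) h(a, b)⁻¹`. -/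
structure GerbeWithConnection (G : SmoothGroupoid.{u}) where
  h : SmoothUnit G.Pairs
  A : DForm 1 G.Arr
  B : DForm 2 G.Obj
  δB : B.pullback G.src G.src_smooth - B.pullback G.tgt G.tgt_smooth = A.d
  δA : A.pullback (fun w : G.Pairs => w.1.2) (dSmooth_snd.comp (dSmooth_val _)) -
      A.pullback G.comp G.comp_smooth +
      A.pullback (fun w : G.Pairs => w.1.1) (dSmooth_fst.comp (dSmooth_val _)) = h.dlog
  δh : ∀ (a b c : G.Arr) (hab : G.tgt a = G.src b) (hbc : G.tgt b = G.src c),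
    h ⟨(b, c), hbc⟩ * (h ⟨(G.mul a b hab, c), (G.tgt_comp _).trans hbc⟩)⁻¹ *
      h ⟨(a, G.mul b c hbc), hab.trans (G.src_comp ⟨(b, c), hbc⟩).symm⟩ *
      (h ⟨(a, b), hab⟩)⁻¹ = 1

/-! ## Inner local systems -/

/-- The structure of an inner local system (in the sense of Ruan) on a line bundle with connection
`L` over the inertia groupoid.  The sectors `X_(g)` are the connected components of the orbifold
represented by the inertia groupoid, so that `L` is the same as the family of its restrictions
`L_(g)` to them.
* `flat`: every `L_(g)` is flat;
* `unit`: `L_(1)` over the untwisted sector is trivialised as a flat line bundle;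
* `pairing`: there is a nondegenerate pairing `L_(g) ⊗ I^* L_(g⁻¹) → 1`, that is, an isomorphism
  of flat line bundles;
* `mult`, `mult_assoc`: there is a multiplication `e₁^* L_(g₁) ⊗ e₂^* L_(g₂) ≅ e₁₂^* L_(g₁g₂)` over
  the 2-sectors, an isomorphism of flat line bundles which is associative over the 3-sectors. -/
structure InnerLocalSystem {G : SmoothGroupoid.{u}} (L : LineBundle G.inertia) where
  flat : L.IsFlat
  unit : LineBundle.Iso (L.pullback G.untwisted) (LineBundle.trivial G)
  pairing : LineBundle.Iso (L.tensor (L.pullback G.involution)) (LineBundle.trivial G.inertia)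
  mult : LineBundle.Iso ((L.pullback G.evalFst).tensor (L.pullback G.evalSnd))
    (L.pullback G.evalMul)
  mult_assoc : ∀ (a b c : G.Loop) (hab : G.tgt a.1 = G.src b.1) (hbc : G.tgt b.1 = G.src c.1),
    mult.f (SmoothGroupoid.loopPair (SmoothGroupoid.loopMul a b hab) c
        ((G.tgt_comp _).trans hbc)) * mult.f (SmoothGroupoid.loopPair a b hab) =
      mult.f (SmoothGroupoid.loopPair a (SmoothGroupoid.loopMul b c hbc)
        (hab.trans (G.src_comp ⟨(b.1, c.1), hbc⟩).symm)) *
        mult.f (SmoothGroupoid.loopPair b c hbc)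

/-- `L = (ρ, ∇)` is the holonomy line bundle of the gerbe with connection `(h, A, B)`:
`ρ(a, b) = h(a, b) / h(b, b⁻¹ab)` and `∇ = A` restricted to the loops. -/
def IsHolonomyBundle {G : SmoothGroupoid.{u}} (𝒢 : GerbeWithConnection G)
    (L : LineBundle G.inertia) : Prop :=
  (∀ (a : G.Loop) (b : G.Arr) (hab : G.tgt a.1 = G.src b),
    L.ρ ⟨(a, b), hab⟩ =
      𝒢.h ⟨(a.1, b), hab⟩ /
        𝒢.h ⟨(b, SmoothGroupoid.conj a.1 b a.2 hab), (SmoothGroupoid.src_conj a.1 b a.2 hab).symm⟩) ∧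
  L.A = 𝒢.A.pullback (fun a : G.Loop => a.1) (dSmooth_val _)

end OrbifoldGerbe

/-! The cocycle `h` is the multiplication of a central extension of `G` by `ℂˣ`: give each arrow `a`
a basis vector `â`, with `â b̂ = h(a,b) (ab)^`. The condition `δh = 1` says exactly that this
product is associative. Since `ab = b · b⁻¹ab`, comparing `â b̂` with `b̂ (b⁻¹ab)^` gives `b̂⁻¹ â b̂
= ρ(a,b) (b⁻¹ab)^`, so `ρ` is conjugation in the extension, read off on the lines over loops.

The algebra of an inner local system is then the algebra of the extension. Conjugation is an action
(`holonomy_mul`) and respects products (`h_conj`), so multiplication in the extension, with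
coefficient `h`, is an equivariant `θ`, associative by `δh = 1`. Over `1ₓ` the line contains the
identity `e` of the extension, with `1̂ₓ = h(1ₓ,1ₓ) e`; this gives the trivialisation, and `â (a⁻¹)^
= h(a,a⁻¹) h(1,1) e` gives the pairing.

The differential conditions all come from one formula (`dlog_hPair`): for smooth families `f`, `g`
with product `k`, `d log h(f,g) = g^*A - k^*A + f^*A`. Flatness is `dA = s^*B - t^*B` together with
`s = t` on loops. -/

namespace OrbifoldGerbe

universe v

open SmoothGroupoid

/-! ### Group structure on forms, quotients of `ℂˣ`-valued functions -/

namespace DForm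

variable {k : ℕ} {X Y : Type v} [DiffeologicalSpace X] [DiffeologicalSpace Y]

instance : Neg (DForm k X) where
  neg α := ⟨fun p hp y => -α.onPlot p hp y, fun p hp => (α.smooth p hp).neg,
    fun p hp f hf y => by rw [α.reparam p hp f hf]; ext; simp⟩

theorem ext_onPlot {α β : DForm k X}
    (h : ∀ {n : ℕ} (p : Eucl n → X) (hp : IsPlot p) (y : Eucl n),
      α.onPlot p hp y = β.onPlot p hp y) : α = β :=
  DForm.ext (by funext n p hp y; exact h p hp y)

/-- Extends the existing zero, sum and difference of forms, so that the connection identities become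
instances of identities provable by `abel`. -/
instance : AddCommGroup (DForm k X) where
  add_assoc _ _ _ := ext_onPlot fun _ _ _ => add_assoc _ _ _
  zero_add _ := ext_onPlot fun _ _ _ => zero_add _
  add_zero _ := ext_onPlot fun _ _ _ => add_zero _
  add_comm _ _ := ext_onPlot fun _ _ _ => add_comm _ _
  neg_add_cancel _ := ext_onPlot fun _ _ _ => neg_add_cancel _
  sub_eq_add_neg _ _ := ext_onPlot fun _ _ _ => sub_eq_add_neg _ _
  nsmul := nsmulRec
  zsmul := zsmulRec

theorem pullback_congr {φ ψ : X → Y} (h : φ = ψ) (hφ : DSmooth φ) (hψ : DSmooth ψ)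
    (α : DForm k Y) : α.pullback φ hφ = α.pullback ψ hψ := by
  subst h; rfl

end DForm

namespace SmoothUnit

variable {X : Type v} [DiffeologicalSpace X]

instance : Div (SmoothUnit X) where
  div f g := ⟨fun x => f x / g x, fun p hp => by
    simpa [div_eq_mul_inv] using
      (f.smooth p hp).mul ((g.smooth p hp).inv fun y => (g (p y)).ne_zero)⟩

theorem dlog_div (f g : SmoothUnit X) : (f / g).dlog = f.dlog - g.dlog := by
  have h : f / g * g = f := SmoothUnit.ext (funext fun x => div_mul_cancel (f x) (g x))
  rw [eq_sub_iff_add_eq, ← dlog_mul, h]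

end SmoothUnit

/-! ### The cocycle identity and its values on units -/

namespace GerbeWithConnection

variable {G : SmoothGroupoid.{v}} (𝒢 : GerbeWithConnection G)

theorem h_congr {a a' b b' : G.Arr} (ha : a = a') (hb : b = b') (w : G.tgt a = G.src b)
    (w' : G.tgt a' = G.src b') : 𝒢.h ⟨(a, b), w⟩ = 𝒢.h ⟨(a', b'), w'⟩ := by
  subst ha hb; rfl

theorem cocycle (a b c : G.Arr) (hab : G.tgt a = G.src b) (hbc : G.tgt b = G.src c) :
    𝒢.h ⟨(b, c), hbc⟩ *
        𝒢.h ⟨(a, G.mul b c hbc), hab.trans (G.src_comp ⟨(b, c), hbc⟩).symm⟩ =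
      𝒢.h ⟨(G.mul a b hab, c), (G.tgt_comp _).trans hbc⟩ * 𝒢.h ⟨(a, b), hab⟩ := by
  have e := 𝒢.δh a b c hab hbc
  rw [mul_inv_eq_one, mul_right_comm, mul_inv_eq_iff_eq_mul] at e
  rw [e, mul_comm]

/-- The cocycle identity with the two composites given up to equality. -/
theorem cocycle_of_eq {a b c ab bc : G.Arr} (hab : G.tgt a = G.src b) (hbc : G.tgt b = G.src c)
    (eab : G.mul a b hab = ab) (ebc : G.mul b c hbc = bc) (w : G.tgt ab = G.src c)
    (w' : G.tgt a = G.src bc) :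
    𝒢.h ⟨(b, c), hbc⟩ * 𝒢.h ⟨(a, bc), w'⟩ = 𝒢.h ⟨(ab, c), w⟩ * 𝒢.h ⟨(a, b), hab⟩ := by
  subst eab ebc
  exact 𝒢.cocycle a b c hab hbc

/-- The cocycle is not assumed normalised, so `h(1,1)` may differ from `1`. The identity for the
triple `(1, 1, b)` has `h(1,b)` on both sides; cancelling one copy leaves the claim. -/
theorem h_one_left (x : G.Obj) (b : G.Arr) (w : G.tgt (G.one x) = G.src b) :
    𝒢.h ⟨(G.one x, b), w⟩ =
      𝒢.h ⟨(G.one x, G.one x), (G.tgt_one x).trans (G.src_one x).symm⟩ := by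
  obtain rfl : x = G.src b := by rw [← w, G.tgt_one]
  refine mul_left_cancel (𝒢.cocycle_of_eq ((G.tgt_one _).trans (G.src_one _).symm) w ?_
    (G.one_comp b) w w)
  exact (mul_congr (congrArg G.one (G.src_one _).symm) rfl _ _).trans (G.one_comp _)

/-- The mirror argument, from the triple `(b, 1, 1)`. -/
theorem h_one_right (x : G.Obj) (b : G.Arr) (w : G.tgt b = G.src (G.one x)) :
    𝒢.h ⟨(b, G.one x), w⟩ =
      𝒢.h ⟨(G.one x, G.one x), (G.tgt_one x).trans (G.src_one x).symm⟩ := by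
  obtain rfl : x = G.tgt b := by rw [w, G.src_one]
  refine (mul_right_cancel (𝒢.cocycle_of_eq w ((G.tgt_one _).trans (G.src_one _).symm)
    (G.comp_one b) ?_ w w)).symm
  exact (mul_congr (congrArg G.one (G.src_one _).symm) rfl _ _).trans (G.one_comp _)

/-! ### Families of composable arrows and the holonomy of conjugation -/

variable {Z : Type v} [DiffeologicalSpace Z]

/-- The function `z ↦ h(f z, g z)` for smooth composable families of arrows `f` and `g`. -/
def hPair {f g : Z → G.Arr} (hf : DSmooth f) (hg : DSmooth g)
    (w : ∀ z, G.tgt (f z) = G.src (g z)) : SmoothUnit Z :=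
  𝒢.h.pullback (fun z => ⟨(f z, g z), w z⟩) (dSmooth_mk (dSmooth_pair hf hg) w)

/-- The condition `δA = d log h` pulled back to `Z`. The product is a separate family `k`, so that
two factorisations of the same arrow produce literally the same term. -/
theorem dlog_hPair {f g k : Z → G.Arr} (hf : DSmooth f) (hg : DSmooth g) (hk : DSmooth k)
    (w : ∀ z, G.tgt (f z) = G.src (g z)) (e : ∀ z, G.mul (f z) (g z) (w z) = k z) :
    (𝒢.hPair hf hg w).dlog = 𝒢.A.pullback g hg - 𝒢.A.pullback k hk + 𝒢.A.pullback f hf := by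
  obtain rfl : (fun z => G.mul (f z) (g z) (w z)) = k := funext e
  -- Pullback commutes with `dlog`, sums, differences and composition definitionally.
  exact (congrArg (DForm.pullback (fun z => (⟨(f z, g z), w z⟩ : G.Pairs))
    (dSmooth_mk (dSmooth_pair hf hg) w)) 𝒢.δA).symm

/-- The holonomy `ρ(a, b) = h(a, b) / h(b, b⁻¹ab)` of the conjugation of a loop `a` by `b`. -/
def holonomy (a b : G.Arr) (ha : G.src a = G.tgt a) (hab : G.tgt a = G.src b) : ℂˣ :=
  𝒢.h ⟨(a, b), hab⟩ / 𝒢.h ⟨(b, conj a b ha hab), (src_conj a b ha hab).symm⟩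

theorem holonomy_congr {a a' b : G.Arr} (e : a = a') (ha : G.src a = G.tgt a)
    (hab : G.tgt a = G.src b) (ha' : G.src a' = G.tgt a') (hab' : G.tgt a' = G.src b) :
    𝒢.holonomy a b ha hab = 𝒢.holonomy a' b ha' hab' := by
  subst e; rfl

/-- Conjugating by `bc` is conjugating by `b`, then by `c`. With `a' = b⁻¹ab` and `a'' = c⁻¹a'c`,
the equalities `abc = ba'c = bca''` call for the cocycle identity on `(a,b,c)`, `(b,a',c)` and
`(b,c,a'')`. -/
theorem holonomy_mul (a b c : G.Arr) (ha : G.src a = G.tgt a) (hab : G.tgt a = G.src b)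
    (hbc : G.tgt b = G.src c) :
    𝒢.holonomy a (G.mul b c hbc) ha (hab.trans (G.src_comp ⟨(b, c), hbc⟩).symm) =
      𝒢.holonomy a b ha hab * 𝒢.holonomy (conj a b ha hab) c (conj_loop a b ha hab)
        ((tgt_conj a b ha hab).trans hbc) := by
  have hb := tgt_conj a b ha hab
  have e₁ := 𝒢.cocycle a b c hab hbc
  have e₂ := 𝒢.cocycle_of_eq hbc (src_conj _ c (conj_loop a b ha hab) (hb.trans hbc)).symm rfl
    (mul_conj _ c (conj_loop a b ha hab) (hb.trans hbc))
    ((G.tgt_comp _).trans (src_conj _ c _ _).symm)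
    ((src_conj a b ha hab).symm.trans
      (G.src_comp ⟨(conj a b ha hab, c), hb.trans hbc⟩).symm)
  have e₃ := 𝒢.cocycle_of_eq (src_conj a b ha hab).symm (hb.trans hbc) (mul_conj a b ha hab) rfl
    ((G.tgt_comp _).trans hbc) ((src_conj a b ha hab).symm.trans
      (G.src_comp ⟨(conj a b ha hab, c), hb.trans hbc⟩).symm)
  have e₄ := 𝒢.h_congr (a := G.mul b c hbc) rfl (conj_conj a b ha hab c hbc)
    ((G.tgt_comp _).trans (src_conj _ c _ _).symm) (src_conj a _ ha _).symm
  rw [e₄] at e₂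
  -- The remaining cancellation in `ℂˣ` is done additively, in an arbitrary abelian group, and
  -- transported by `Additive ℂˣ`. The auxiliary values `m = h(b,c)`, `s = h(ab,c)`, `t = h(b,a'c)`
  -- drop out.
  have key : ∀ {M : Type} [AddCommGroup M] {P Q x y z w m s t : M}, m + P = s + x →
      w + t = Q + m → z + t = s + y → P - Q = (x - y) + (z - w) := by
    intro M _ P Q x y z w m s t e₁ e₂ e₃
    linear_combination (norm := abel) e₁ + e₂ - e₃
  exact key (M := Additive ℂˣ) e₁ e₂ e₃

/-- Conjugation by `g` respects products in the extension: this makes `θ = h` equivariant, and `b =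
a⁻¹` gives the pairing. Writing `xᵍ = g⁻¹xg`, moving `g` leftwards in `abg = a g bᵍ = g aᵍ bᵍ` uses
the cocycle identity on `(a,b,g)`, `(a,g,bᵍ)` and `(g,aᵍ,bᵍ)`. -/
theorem h_conj (a b g : G.Arr) (ha : G.src a = G.tgt a) (hb : G.src b = G.tgt b)
    (hab : G.tgt a = G.src b) (hg : G.tgt b = G.src g) :
    𝒢.h ⟨(conj a g ha ((hab.trans hb).trans hg), conj b g hb hg),
        (tgt_conj a g ha ((hab.trans hb).trans hg)).trans (src_conj b g hb hg).symm⟩ *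
        (𝒢.holonomy a g ha ((hab.trans hb).trans hg) * 𝒢.holonomy b g hb hg) =
      𝒢.holonomy (G.mul a b hab) g
          (((G.src_comp _).trans ((ha.trans hab).trans hb)).trans (G.tgt_comp _).symm)
          ((G.tgt_comp _).trans hg) *
        𝒢.h ⟨(a, b), hab⟩ := by
  have hag : G.tgt a = G.src g := (hab.trans hb).trans hg
  have w : G.tgt (conj a g ha hag) = G.src (conj b g hb hg) :=
    (tgt_conj _ _ _ _).trans (src_conj _ _ _ _).symm
  have hs : G.tgt g = G.src (conj b g hb hg) := (src_conj b g hb hg).symm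
  have e₁ := 𝒢.cocycle a b g hab hg
  have e₂ := 𝒢.cocycle_of_eq (src_conj a g ha hag).symm w (mul_conj a g ha hag)
    (conj_mul a g ha hag b hb hab) ((G.tgt_comp _).trans hs) (src_conj _ g _ _).symm
  have e₃ := 𝒢.cocycle_of_eq hag hs rfl (mul_conj b g hb hg) ((G.tgt_comp _).trans hs)
    (hab.trans (G.src_comp ⟨(b, g), hg⟩).symm)
  have key : ∀ {M : Type} [AddCommGroup M] {P Q x y z w p m s t : M}, z + t = P + m →
      p + Q = s + y → w + t = s + x → p + ((x - y) + (z - w)) = (P - Q) + m := by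
    intro M _ P Q x y z w p m s t e₁ e₂ e₃
    linear_combination (norm := abel) e₁ + e₂ - e₃
  exact key (M := Additive ℂˣ) e₁ e₂ e₃

/-- The function `x ↦ h(1ₓ, 1ₓ)`. -/
def hOne : SmoothUnit G.Obj :=
  𝒢.hPair G.one_smooth G.one_smooth fun x => (G.tgt_one x).trans (G.src_one x).symm

/-- All three families in `dlog_hPair` are `x ↦ 1ₓ`, and `A - A + A = A`. -/
theorem dlog_hOne : 𝒢.hOne.dlog = 𝒢.A.pullback G.one G.one_smooth := by
  refine (𝒢.dlog_hPair G.one_smooth G.one_smooth G.one_smooth _ fun x => ?_).trans (by abel)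
  exact (mul_congr (congrArg G.one (G.src_one x).symm) rfl _ _).trans (G.one_comp _)

/-- Conjugating `1ₓ` by `g` gives the unit at the target of `g`; both values of `h` then have a unit
as one argument. -/
theorem holonomy_one (x : G.Obj) (g : G.Arr) (h1 : G.src (G.one x) = G.tgt (G.one x))
    (hg : G.tgt (G.one x) = G.src g) :
    𝒢.holonomy (G.one x) g h1 hg = 𝒢.hOne x / 𝒢.hOne (G.tgt g) := by
  obtain rfl : x = G.src g := by rw [← hg, G.tgt_one]
  refine congrArg₂ (· / ·) (𝒢.h_one_left _ g hg) ?_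
  exact (𝒢.h_congr rfl (conj_of_one g) _ (G.src_one _).symm).trans (𝒢.h_one_right _ g _)

/-! ### The holonomy bundle and its inner local system -/

/-- The holonomy line bundle of a gerbe with connection over the inertia groupoid. -/
def holonomyBundle : LineBundle G.inertia where
  ρ := 𝒢.hPair (Z := G.inertia.Arr) (f := fun w => w.1.1.1) (g := fun w => w.1.2)
      ((dSmooth_val _).comp (dSmooth_fst.comp (dSmooth_val _)))
      (dSmooth_snd.comp (dSmooth_val _)) (fun w => w.2) /
    𝒢.hPair (Z := G.inertia.Arr) (f := fun w => w.1.2)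
      (g := fun w => conj w.1.1.1 w.1.2 w.1.1.2 w.2)
      (dSmooth_snd.comp (dSmooth_val _))
      ((dSmooth_val _).comp G.inertia.tgt_smooth) (fun _ => (src_conj _ _ _ _).symm)
  A := 𝒢.A.pullback (fun a : G.Loop => a.1) (dSmooth_val _)
  ρ_mul := by
    rintro ⟨⟨⟨a, ha⟩, b⟩, hab⟩ ⟨⟨⟨c, hc⟩, b'⟩, hcb⟩ w
    obtain rfl : conj a b ha hab = c := congrArg Subtype.val w
    exact 𝒢.holonomy_mul a b b' ha hab ((tgt_conj a b ha hab).symm.trans hcb)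
  conn := by
    have hk : DSmooth fun w : G.inertia.Arr => G.mul w.1.1.1 w.1.2 w.2 :=
      dSmooth_mul ((dSmooth_val _).comp (dSmooth_fst.comp (dSmooth_val _)))
        (dSmooth_snd.comp (dSmooth_val _)) _
    -- Numerator and denominator of `ρ` share the product `ab = b · b⁻¹ab`, so the terms `(ab)^*A`
    -- and `b^*A` cancel, leaving source minus target.
    rw [SmoothUnit.dlog_div, 𝒢.dlog_hPair _ _ hk _ (fun _ => rfl),
      𝒢.dlog_hPair _ _ hk _ (fun w => mul_conj w.1.1.1 w.1.2 w.1.1.2 w.2)]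
    -- The goal has this shape only after unfolding composed pullbacks, which unification does when
    -- the abstract identity is applied.
    have key : ∀ {M : Type v} [AddCommGroup M] (p q r t : M),
        p - q = r - t + p - (q - t + r) := by
      intros; abel
    exact key _ _ _ _

theorem isHolonomyBundle : IsHolonomyBundle 𝒢 𝒢.holonomyBundle := ⟨fun _ _ _ => rfl, rfl⟩

/-- The holonomy line bundle of a gerbe with connection is an inner local system. -/
def innerLocalSystem : InnerLocalSystem 𝒢.holonomyBundle where
  flat := by
    -- `d` is computed plot by plot, hence commutes with pullback by definition.
    have e : 𝒢.holonomyBundle.A.d = 𝒢.A.d.pullback (fun a : G.Loop => a.1) (dSmooth_val _) := rfl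
    refine e.trans ?_
    rw [← 𝒢.δB]
    refine sub_eq_zero.2 (DForm.pullback_congr (φ := fun a : G.Loop => G.src a.1)
      (ψ := fun a : G.Loop => G.tgt a.1) (funext fun a => a.2) (G.src_smooth.comp (dSmooth_val _))
      (G.tgt_smooth.comp (dSmooth_val _)) 𝒢.B)
  unit :=
    { f := 𝒢.hOne
      equivariant := fun g => by
        refine (congrArg (𝒢.hOne (G.tgt g) * ·) (𝒢.holonomy_one _ g _ (G.tgt_one _))).trans ?_
        exact (mul_div_cancel _ _).trans (one_mul _).symm
      parallel := (sub_zero _).trans 𝒢.dlog_hOne.symm }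
  pairing :=
    -- The product of the basis vectors over `a` and `a⁻¹` lands over `1`; the second factor,
    -- `h(1,1)`, is the trivialisation there.
    { f := 𝒢.hPair (dSmooth_val _) (G.inv_smooth.comp (dSmooth_val _))
          (fun a : G.Loop => (G.src_inv a.1).symm) *
        𝒢.hOne.pullback (fun a : G.Loop => G.src a.1) (G.src_smooth.comp (dSmooth_val _))
      equivariant := by
        rintro ⟨⟨⟨a, ha⟩, g⟩, hg⟩
        have hi : G.src (G.inv a) = G.tgt (G.inv a) := (invLoop ⟨a, ha⟩).2
        have hig : G.tgt (G.inv a) = G.src g := (G.tgt_inv a).trans (ha.trans hg)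
        have e := 𝒢.h_conj a (G.inv a) g ha hi (G.src_inv a).symm hig
        -- Since `a a⁻¹ = 1`, its holonomy is a quotient of values of `hOne`; the conjugate of `a⁻¹`
        -- is the inverse of the conjugate of `a`.
        rw [𝒢.holonomy_congr (G.comp_inv a) _ _ ((G.src_one _).trans (G.tgt_one _).symm)
            ((G.tgt_one _).trans (ha.trans hg)), 𝒢.holonomy_one,
          𝒢.h_congr rfl (conj_inv a g ha hg) _ (G.src_inv _).symm] at e
        have key : ∀ {M : Type} [AddCommGroup M] {p r s t u : M},
            p + r = s - t + u → p + t + r = 0 + (u + s) := by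
          intro M _ p r s t u e
          linear_combination (norm := abel) e
        refine Eq.trans ?_ (key (M := Additive ℂˣ) e)
        -- The witness evaluates `hOne` at the source of the conjugated loop, which is only
        -- propositionally the target of `g`.
        exact congrArg (fun x => 𝒢.h ⟨(conj a g ha hg, G.inv (conj a g ha hg)), (G.src_inv _).symm⟩ *
          𝒢.hOne x * (𝒢.holonomy a g ha hg * 𝒢.holonomy (G.inv a) g hi hig)) (src_conj a g ha hg)
      parallel := by
        have hk : DSmooth fun a : G.Loop => G.one (G.src a.1) :=
          G.one_smooth.comp (G.src_smooth.comp (dSmooth_val _))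
        have e : (𝒢.hOne.pullback (fun a : G.Loop => G.src a.1)
            (G.src_smooth.comp (dSmooth_val _))).dlog = 𝒢.A.pullback _ hk :=
          congrArg (DForm.pullback (fun a : G.Loop => G.src a.1)
            (G.src_smooth.comp (dSmooth_val _))) 𝒢.dlog_hOne
        -- The factor `hOne` contributes the pullback of `A` along the constant loops, cancelling
        -- the product term of `h(a, a⁻¹)`.
        rw [SmoothUnit.dlog_mul, e, 𝒢.dlog_hPair _ _ hk _ fun a => G.comp_inv a.1]
        have key : ∀ {M : Type v} [AddCommGroup M] (p q r : M),
            p + q - 0 = q - r + p + r := by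
          intros; abel
        exact key _ _ _ }
  mult :=
    { f := 𝒢.hPair (Z := G.LoopPair) (f := fun w => w.1.1) (g := fun w => w.1.2)
        (dSmooth_fst.comp (dSmooth_val _)) (dSmooth_snd.comp (dSmooth_val _)) (fun w => w.2.2)
      equivariant := fun w =>
        𝒢.h_conj w.1.1.1.1 w.1.1.1.2 w.1.2 w.1.1.2.1.1 w.1.1.2.1.2 w.1.1.2.2 (loopPair_snd _ w.2)
      parallel := by
        have hk : DSmooth fun w : G.LoopPair => G.mul w.1.1 w.1.2 w.2.2 :=
          dSmooth_mul (dSmooth_fst.comp (dSmooth_val _)) (dSmooth_snd.comp (dSmooth_val _)) _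
        rw [𝒢.dlog_hPair _ _ hk _ fun _ => rfl]
        have key : ∀ {M : Type v} [AddCommGroup M] (p q r : M), p + q - r = q - r + p := by
          intros; abel
        exact key _ _ _ }
  mult_assoc a b c hab hbc :=
    -- Associativity of `θ = h` is `δh = 1` on triples of loops.
    ((mul_comm _ _).trans (𝒢.cocycle a.1 b.1 c.1 hab hbc)).symm

end GerbeWithConnection

end OrbifoldGerbe
theorem mainTheorem7 {n : ℕ} {G : OrbifoldGerbe.SmoothGroupoid}
    (hG : OrbifoldGerbe.Orbifold n G) (𝒢 : OrbifoldGerbe.GerbeWithConnection G) :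
    ∃ L : OrbifoldGerbe.LineBundle G.inertia,
      OrbifoldGerbe.IsHolonomyBundle 𝒢 L ∧ Nonempty (OrbifoldGerbe.InnerLocalSystem L) := by
  exact ⟨𝒢.holonomyBundle, 𝒢.isHolonomyBundle, ⟨𝒢.innerLocalSystem⟩⟩
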